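/- Let $\mathbb P_0,\mathbb P_1$ be finite Borel measures on $\mathbb R$, $\mathbb P=\mathbb P_0+\mathbb P_1$ and $\eta=d\mathbb P_1/d\mathbb P$. For $\epsilon\ge 0$ and $A\subset\mathbb R$ let $A^\epsilon=A+[-\epsilon,\epsilon]$ and let \[R^\epsilon(A)=\int \mathbf 1_{(A^C)^\epsilon}\,d\mathbb P_1+\int \mathbf 1_{A^\epsilon}\,d\mathbb P_0 .\] A Borel set that minimizes $R^\epsilon$ over all Borel sets is called an adversarial Bayes classifier for the radius $\epsilon$. It is called regular if both it and its complement are disjoint unions of intervals (possibly unbounded, possibly none) of length strictly greater than $2\epsilon$. Let $\operatorname{comp}(E)\in\mathbb N\cup\{\infty\}$ denote the number of connected components of $E\subset \mathbb R$, with $\operatorname{comp}(\emptyset)=0$. Theorem. Assume that $\mathbb P$ is absolutely continuous with respect to Lebesgue measure, that $I=\operatorname{supp}\mathbb P$ is an interval, and that $\mathbb P(\eta\in\{0,1\})=0$. Let $0\le\epsilon_1<\epsilon_2$, let $A_1,A_2$ be regular adversarial Bayes classifiers for the radii $\epsilon_1,\epsilon_2$ respectively, and let $J_i=\operatorname{int}(I^{\epsilon_i})$.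 Call $A_1,A_2$ opposite constant classifiers if either $J_1\subset A_1$ and $J_2\cap A_2=\emptyset$, or $J_1\cap A_1=\emptyset$ and $J_2\subset A_2$. 1. If $A_1,A_2$ are not opposite constant classifiers, then \[\operatorname{comp}(A_1\cap J_1)\ge \operatorname{comp}(A_2\cap J_2)\quad\text{and}\quad \operatorname{comp}(A_1^C\cap J_1)\ge \operatorname{comp}(A_2^C\cap J_2).\] If in addition no boundary point of $A_2$ is a boundary point of $I^{\epsilon_2}$, then also \[\operatorname{comp}(A_1\cap I^{\epsilon_1})\ge \operatorname{comp}(A_2\cap I^{\epsilon_2})\quad\text{and}\quad \operatorname{comp}(A_1^C\cap I^{\epsilon_1})\ge \operatorname{comp}(A_2^C\cap I^{\epsilon_2}).\] 2. If $A_1,A_2$ are opposite constant classifiers, then $\emptyset$ and $\mathbb R$ are both adversarial Bayes classifiers for both radii $\epsilon_1$ and $\epsilon_2$. (In particular, part 1 applies whenever $\emptyset$ and $\mathbb R$ are not both adversarial Bayes classifiers for the radius $\epsilon_1$.) -/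

import Mathlib

open MeasureTheory Set
open scoped ENNReal Pointwise

noncomputable section

namespace AdvBayes

/-- The `ε`-expansion `A^ε = A ⊕ closedBall 0 ε` of a subset of the real line. -/
def expansion (ε : ℝ) (A : Set ℝ) : Set ℝ := A + Metric.closedBall (0 : ℝ) ε

/-- The adversarial classification risk
`R^ε(A) = ∫ 1_{(Aᶜ)^ε} dP₁ + ∫ 1_{A^ε} dP₀`. On the real line the `ε`-expansion of a Borel set is
again Borel, so for Borel `A` both terms are measures of Borel sets. -/
def advRisk (P₀ P₁ : Measure ℝ) (ε : ℝ) (A : Set ℝ) : ℝ≥0∞ :=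
  P₁ (expansion ε Aᶜ) + P₀ (expansion ε A)

/-- An adversarial Bayes classifier for the radius `ε`: a Borel set that minimizes the adversarial
classification risk among all Borel sets. -/
def IsAdvBayes (P₀ P₁ : Measure ℝ) (ε : ℝ) (A : Set ℝ) : Prop :=
  MeasurableSet A ∧ ∀ B : Set ℝ, MeasurableSet B → advRisk P₀ P₁ ε A ≤ advRisk P₀ P₁ ε B

/-- `E` is a disjoint union of intervals of length strictly greater than `L`. The intervals may be
unbounded, may or may not contain their endpoints, and the family may be empty. -/
def IsUnionOfLongIntervals (L : ℝ) (E : Set ℝ) : Prop :=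
  ∃ S : Set (Set ℝ), S.PairwiseDisjoint id ∧ ⋃₀ S = E ∧
    ∀ J ∈ S, J.OrdConnected ∧ ENNReal.ofReal L < volume J

/-- `E` is a regular set of radius `ε`: both `E` and its complement are disjoint unions of intervals
of length strictly greater than `2ε`. -/
def IsRegularSet (ε : ℝ) (E : Set ℝ) : Prop :=
  IsUnionOfLongIntervals (2 * ε) E ∧ IsUnionOfLongIntervals (2 * ε) Eᶜ

/-- The number of connected components of a set, in `ℕ ∪ {∞}` (it is `0` for the empty set). -/
def comp (A : Set ℝ) : ℕ∞ := ENat.card (ConnectedComponents A)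

/-- The classifiers `A₁` on `J₁` and `A₂` on `J₂` are constant and of opposite labels: one of them
contains the whole of its set `Jᵢ` while the other one does not meet its set. -/
def AreOppositeConstant (J₁ J₂ A₁ A₂ : Set ℝ) : Prop :=
  (J₁ ⊆ A₁ ∧ Disjoint J₂ A₂) ∨ (Disjoint J₁ A₁ ∧ J₂ ⊆ A₂)

end AdvBayes

end

/-! Fix a component `D` of `A₂ᶜ` meeting `J₂`. As `A₂` is regular, filling `D` frees all of `D^ε₂`
in the `P₁` term and costs at most the erosion, so `P₁ (D^ε₂) ≤ P₀ (erosion ε₂ D)`. If `D ∩ J₁ ⊆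
A₁`, removing `D` from `A₁` gives `P₀ (erosion ε₁ D) ≤ P₁ (D^ε₁)`. Expansions grow and erosions
shrink with the radius, so all four numbers agree; as `η ∉ {0, 1}`, `P` vanishes on the collars
between the two radii, on both sides of the endpoints of `D`. If `D` does not cover `J₂`, these
collars trap the interval `I` within `ε₁` of one endpoint, where the erosion is null, and then `P =
0`. So `D` covers `J₂` (`interior_expansion_subset_component`).

Swapping labels gives the same for `A₂`. Hence, unless the pair is opposite constant, each component
of `A₂ ∩ J₂` contains a point of `A₁ ∩ J₁`, and points from different components are separated by a
gap that must meet `A₁ᶜ`. This injects components of `A₂ ∩ J₂` into those of `A₁ ∩ J₁`. In the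
opposite constant case, constant classifiers have risks independent of the radius, so optimality at
both radii forces a tie. -/

namespace AdvBayes

/-! ### Expansions, erosions and long intervals -/

lemma mem_expansion {ε : ℝ} {A : Set ℝ} {x : ℝ} :
    x ∈ expansion ε A ↔ ∃ a ∈ A, |x - a| ≤ ε := by
  simp only [expansion, Set.mem_add, Metric.mem_closedBall, dist_zero_right, Real.norm_eq_abs]
  constructor
  · rintro ⟨a, ha, b, hb, rfl⟩
    exact ⟨a, ha, by simpa using hb⟩
  · rintro ⟨a, ha, h⟩
    exact ⟨a, ha, x - a, h, by ring⟩

lemma expansion_mono {ε δ : ℝ} (h : ε ≤ δ) {A B : Set ℝ} (hAB : A ⊆ B) :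
    expansion ε A ⊆ expansion δ B := fun x hx ↦ by
  obtain ⟨a, ha, hxa⟩ := mem_expansion.1 hx
  exact mem_expansion.2 ⟨a, hAB ha, hxa.trans h⟩

lemma subset_expansion {ε : ℝ} (hε : 0 ≤ ε) (A : Set ℝ) : A ⊆ expansion ε A :=
  fun x hx ↦ mem_expansion.2 ⟨x, hx, by simpa using hε⟩

lemma expansion_union (ε : ℝ) (A B : Set ℝ) :
    expansion ε (A ∪ B) = expansion ε A ∪ expansion ε B := Set.union_add

@[simp] lemma expansion_empty (ε : ℝ) : expansion ε ∅ = ∅ := Set.empty_add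

lemma expansion_univ {ε : ℝ} (hε : 0 ≤ ε) : expansion ε univ = univ :=
  univ_subset_iff.1 (subset_expansion hε univ)

lemma expansion_neg (ε : ℝ) (A : Set ℝ) : expansion ε (-A) = -expansion ε A := by
  ext x
  simp only [Set.mem_neg, mem_expansion]
  constructor
  · rintro ⟨a, ha, h⟩
    exact ⟨-a, ha, by rwa [abs_sub_comm, neg_sub_neg, abs_sub_comm, abs_sub_comm]⟩
  · rintro ⟨a, ha, h⟩
    refine ⟨-a, by simpa using ha, ?_⟩
    rwa [sub_neg_eq_add, ← abs_neg, neg_add, ← sub_eq_add_neg]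

lemma ordConnected_expansion (ε : ℝ) {D : Set ℝ} (hD : D.OrdConnected) :
    (expansion ε D).OrdConnected :=
  (hD.convex.add (convex_closedBall (0 : ℝ) ε)).ordConnected

/-- The `ε`-erosion of a set: the points whose closed `ε`-ball lies in the set. -/
def erosion (ε : ℝ) (A : Set ℝ) : Set ℝ := (expansion ε Aᶜ)ᶜ

lemma mem_erosion {ε : ℝ} {A : Set ℝ} {x : ℝ} :
    x ∈ erosion ε A ↔ ∀ a, |x - a| ≤ ε → a ∈ A := by
  simp only [erosion, Set.mem_compl_iff, mem_expansion, not_exists, not_and']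
  exact forall_congr' fun a ↦ forall_congr' fun _ ↦ not_not

lemma erosion_anti {ε δ : ℝ} (h : ε ≤ δ) (A : Set ℝ) : erosion δ A ⊆ erosion ε A :=
  compl_subset_compl.2 (expansion_mono h Subset.rfl)

lemma erosion_subset {ε : ℝ} (hε : 0 ≤ ε) (A : Set ℝ) : erosion ε A ⊆ A :=
  compl_subset_comm.1 (subset_expansion hε Aᶜ)

lemma erosion_neg (ε : ℝ) (A : Set ℝ) : erosion ε (-A) = -erosion ε A := by
  have h : (-A)ᶜ = -Aᶜ := rfl
  rw [erosion, h, expansion_neg]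
  rfl

lemma ordConnected_erosion (ε : ℝ) {D : Set ℝ} (hD : D.OrdConnected) :
    (erosion ε D).OrdConnected := by
  refine ⟨fun x hx y hy z hz ↦ mem_erosion.2 fun a ha ↦ ?_⟩
  have h₁ := mem_erosion.1 hx (x + (a - z)) (by rw [abs_sub_comm] at ha ⊢; simpa using ha)
  have h₂ := mem_erosion.1 hy (y + (a - z)) (by rw [abs_sub_comm] at ha ⊢; simpa using ha)
  exact hD.out h₁ h₂ ⟨by linarith [hz.1], by linarith [hz.2]⟩

/-- Pieces of the union may abut, so they need not be components; still, the piece through `x` lies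
in the component of `x` and bounds its length from below. -/
lemma IsUnionOfLongIntervals.lt_of_subset_Icc {L : ℝ} {E : Set ℝ}
    (hE : IsUnionOfLongIntervals L E) {x a b : ℝ} (hx : x ∈ E)
    (h : E.ordConnectedComponent x ⊆ Icc a b) : L < b - a := by
  obtain ⟨S, -, rfl, hS⟩ := hE
  obtain ⟨J, hJ, hxJ⟩ := hx
  obtain ⟨hJo, hJL⟩ := hS J hJ
  have hJD : J ⊆ (⋃₀ S).ordConnectedComponent x :=
    fun y hy ↦ (hJo.uIcc_subset hxJ hy).trans (subset_sUnion_of_mem hJ)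
  have := hJL.trans_le (measure_mono (hJD.trans h))
  rw [Real.volume_Icc] at this
  exact (ENNReal.ofReal_lt_ofReal_iff'.1 this).1

/-! ### Counting components -/

/-- Membership in a common connected component of a subset of the line. -/
lemma connectedComponents_mk_eq_iff {A : Set ℝ} (x y : A) :
    ConnectedComponents.mk x = ConnectedComponents.mk y ↔ uIcc (x : ℝ) y ⊆ A := by
  rw [ConnectedComponents.coe_eq_coe']
  constructor
  · intro h
    have hc : (Subtype.val '' connectedComponent y).OrdConnected :=
      (isPreconnected_connectedComponent.image _ continuous_subtype_val.continuousOn).ordConnected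
    exact (hc.uIcc_subset (mem_image_of_mem _ h) (mem_image_of_mem _ mem_connectedComponent)).trans
      (by simp)
  · intro h
    have hc : IsPreconnected (Subtype.val ⁻¹' uIcc (x : ℝ) y : Set A) := by
      rw [← Topology.IsInducing.subtypeVal.isPreconnected_image, Subtype.image_preimage_coe,
        inter_eq_right.2 h]
      exact isPreconnected_uIcc
    exact hc.subset_connectedComponent (by simp) (by simp)

/-- Send a component of `B` to the component of `A` through a chosen common point: `h₁` supplies the
point, `h₂` gives injectivity. -/
lemma comp_le_comp {A B : Set ℝ} (h₁ : ∀ x ∈ B, ∃ y ∈ A, uIcc x y ⊆ B)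
    (h₂ : ∀ x ∈ A ∩ B, ∀ y ∈ A ∩ B, uIcc x y ⊆ A → uIcc x y ⊆ B) : comp B ≤ comp A := by
  have key (c : ConnectedComponents B) :
      ∃ y : B, ConnectedComponents.mk y = c ∧ (y : ℝ) ∈ A := by
    obtain ⟨x, rfl⟩ := ConnectedComponents.surjective_coe c
    obtain ⟨y, hy, hxy⟩ := h₁ x x.2
    exact ⟨⟨y, hxy right_mem_uIcc⟩,
      (connectedComponents_mk_eq_iff _ _).2 (by rwa [uIcc_comm]), hy⟩
  choose f hf hfA using key
  refine ENat.card_le_card_of_injective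
    (f := fun c ↦ (ConnectedComponents.mk (⟨f c, hfA c⟩ : A))) fun c d hcd ↦ ?_
  rw [← hf c, ← hf d, connectedComponents_mk_eq_iff]
  exact h₂ _ ⟨hfA c, (f c).2⟩ _ ⟨hfA d, (f d).2⟩ ((connectedComponents_mk_eq_iff _ _).1 hcd)

/-! ### Mutual absolute continuity from `η ∉ {0, 1}` -/

lemma absolutelyContinuous_of_rnDeriv_ne_zero {μ ν : Measure ℝ} [IsFiniteMeasure μ]
    [IsFiniteMeasure ν] (hμν : μ ≪ ν) (h : ∀ᵐ x ∂ν, μ.rnDeriv ν x ≠ 0) : ν ≪ μ := by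
  refine Measure.AbsolutelyContinuous.mk fun s hs hμs ↦ ?_
  rw [← Measure.setLIntegral_rnDeriv hμν,
    setLIntegral_eq_zero_iff hs (Measure.measurable_rnDeriv _ _)] at hμs
  rw [measure_eq_zero_iff_ae_notMem]
  filter_upwards [h, hμs] with x h₁ h₂ h₃ using h₁ (h₂ h₃)

lemma absolutelyContinuous_of_rnDeriv {P₀ P₁ : Measure ℝ} [IsFiniteMeasure P₀]
    [IsFiniteMeasure P₁]
    (hη : (P₀ + P₁) {x | P₁.rnDeriv (P₀ + P₁) x = 0 ∨ P₁.rnDeriv (P₀ + P₁) x = 1} = 0) :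
    P₀ + P₁ ≪ P₀ ∧ P₀ + P₁ ≪ P₁ := by
  have hη' : ∀ᵐ x ∂(P₀ + P₁),
      ¬(P₁.rnDeriv (P₀ + P₁) x = 0 ∨ P₁.rnDeriv (P₀ + P₁) x = 1) := by
    rw [ae_iff]
    simpa only [not_not] using hη
  constructor
  · refine absolutelyContinuous_of_rnDeriv_ne_zero
      (Measure.le_add_right le_rfl).absolutelyContinuous ?_
    filter_upwards [hη', Measure.rnDeriv_add' P₀ P₁ (P₀ + P₁),
      Measure.rnDeriv_self (P₀ + P₁)] with x h₁ h₂ h₃ h₄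
    rw [h₃, Pi.add_apply, h₄, zero_add] at h₂
    exact h₁ (Or.inr h₂.symm)
  · refine absolutelyContinuous_of_rnDeriv_ne_zero
      (Measure.le_add_left le_rfl).absolutelyContinuous ?_
    filter_upwards [hη'] with x hx h using hx (Or.inl h)

/-! ### Modifying a minimizer on one interval -/

lemma advRisk_compl (P₀ P₁ : Measure ℝ) (ε : ℝ) (A : Set ℝ) :
    advRisk P₁ P₀ ε Aᶜ = advRisk P₀ P₁ ε A := by
  rw [advRisk, advRisk, compl_compl, add_comm]

lemma IsAdvBayes.compl {P₀ P₁ : Measure ℝ} {ε : ℝ} {A : Set ℝ} (h : IsAdvBayes P₀ P₁ ε A) :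
    IsAdvBayes P₁ P₀ ε Aᶜ := by
  refine ⟨h.1.compl, fun B hB ↦ ?_⟩
  rw [advRisk_compl, ← advRisk_compl P₁ P₀]
  exact h.2 _ hB.compl

lemma IsRegularSet.compl {ε : ℝ} {A : Set ℝ} (h : IsRegularSet ε A) : IsRegularSet ε Aᶜ :=
  ⟨h.2, by rw [compl_compl]; exact h.1⟩

/-- Flipping the label on an interval inside a minimizer cannot decrease the risk. -/
lemma IsAdvBayes.measure_erosion_le {P₀ P₁ : Measure ℝ} [IsFiniteMeasure P₀] [IsFiniteMeasure P₁]
    {ε : ℝ} (hε : 0 ≤ ε) {A D : Set ℝ} (hA : IsAdvBayes P₀ P₁ ε A) (hD : D.OrdConnected)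
    (hDA : D ⊆ A) : P₀ (erosion ε D) ≤ P₁ (expansion ε D) := by
  have h := hA.2 (A \ D) (hA.1.diff hD.measurableSet)
  have h₁ : P₁ (expansion ε (A \ D)ᶜ) ≤ P₁ (expansion ε Aᶜ) + P₁ (expansion ε D) := by
    rw [sdiff_eq, compl_inter, compl_compl, expansion_union]
    exact measure_union_le _ _
  have h₂ : P₀ (expansion ε (A \ D)) + P₀ (erosion ε D) ≤ P₀ (expansion ε A) := by
    rw [← measure_union _ (ordConnected_erosion ε hD).measurableSet]
    · exact measure_mono (union_subset (expansion_mono le_rfl sdiff_subset)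
        ((erosion_subset hε D).trans (hDA.trans (subset_expansion hε A))))
    · rw [erosion, disjoint_compl_right_iff_subset]
      exact expansion_mono le_rfl fun x hx ↦ hx.2
  have hfin : P₁ (expansion ε Aᶜ) + P₀ (expansion ε (A \ D)) ≠ ∞ := by finiteness
  refine (ENNReal.add_le_add_iff_left hfin).1 ?_
  calc P₁ (expansion ε Aᶜ) + P₀ (expansion ε (A \ D)) + P₀ (erosion ε D)
      ≤ advRisk P₀ P₁ ε A := by rw [add_assoc]; exact add_le_add le_rfl h₂
    _ ≤ P₁ (expansion ε (A \ D)ᶜ) + P₀ (expansion ε (A \ D)) := h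
    _ ≤ P₁ (expansion ε Aᶜ) + P₁ (expansion ε D) + P₀ (expansion ε (A \ D)) :=
        add_le_add h₁ le_rfl
    _ = _ := by ring

/-- Filling a component of the complement of a regular minimizer cannot decrease the risk. -/
lemma IsAdvBayes.measure_expansion_le {P₀ P₁ : Measure ℝ} [IsFiniteMeasure P₀]
    [IsFiniteMeasure P₁] {ε : ℝ} {A : Set ℝ} (hA : IsAdvBayes P₀ P₁ ε A)
    (hreg : IsRegularSet ε A) (x : ℝ) :
    P₁ (expansion ε (Aᶜ.ordConnectedComponent x)) ≤
      P₀ (erosion ε (Aᶜ.ordConnectedComponent x)) := by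
  set D := Aᶜ.ordConnectedComponent x with hDdef
  have hD : D.OrdConnected := inferInstance
  have hDA : D ⊆ Aᶜ := ordConnectedComponent_subset
  have hbetween : ∀ y ∈ D, ∀ z ∉ D, ∃ a ∈ uIcc y z, a ∈ A := by
    intro y hy z hz
    by_contra! hcon
    exact hz (mem_ordConnectedComponent_trans hy fun a ha ↦ hcon a ha)
  have h := hA.2 (A ∪ D) (hA.1.union hD.measurableSet)
  have h₁ : P₁ (expansion ε (A ∪ D)ᶜ) + P₁ (expansion ε D) ≤ P₁ (expansion ε Aᶜ) := by
    rw [← measure_union _ (ordConnected_expansion ε hD).measurableSet]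
    · exact measure_mono (union_subset
        (expansion_mono le_rfl (compl_subset_compl.2 subset_union_left))
        (expansion_mono le_rfl hDA))
    · rw [disjoint_left]
      intro w hw₁ hw₂
      obtain ⟨z, hz, hwz⟩ := mem_expansion.1 hw₁
      obtain ⟨y, hy, hwy⟩ := mem_expansion.1 hw₂
      rw [mem_compl_iff, mem_union, not_or] at hz
      obtain ⟨a, ha, haA⟩ := hbetween y hy z hz.2
      -- The component of `A` through `a` is trapped between `y` and `z`, which are at most `2ε`
      -- apart; regularity forbids this.
      have hsub : A.ordConnectedComponent a ⊆ Icc (y ⊓ z) (y ⊔ z) := by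
        intro b hb
        by_contra hcon
        have hy' : y ∉ uIcc a b := fun h ↦ hDA hy (hb h)
        have hz' : z ∉ uIcc a b := fun h ↦ hz.1 (hb h)
        simp only [mem_uIcc, mem_Icc, inf_le_iff, le_sup_iff] at ha hcon hy' hz'
        grind
      have := hreg.1.lt_of_subset_Icc haA hsub
      rw [max_sub_min_eq_abs] at this
      rw [abs_le] at hwz hwy
      rcases abs_cases (z - y) with h | h <;> linarith
  have h₂ : P₀ (expansion ε (A ∪ D)) ≤ P₀ (expansion ε A) + P₀ (erosion ε D) := by
    refine (measure_mono ?_).trans (measure_union_le _ _)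
    rw [expansion_union]
    refine union_subset subset_union_left fun w hw ↦ ?_
    by_cases hwe : w ∈ erosion ε D
    · exact Or.inr hwe
    obtain ⟨y, hy, hwy⟩ := mem_expansion.1 hw
    rw [erosion, mem_compl_iff, not_not] at hwe
    obtain ⟨z, hz, hwz⟩ := mem_expansion.1 hwe
    obtain ⟨a, ha, haA⟩ := hbetween y hy z hz
    refine Or.inl (mem_expansion.2 ⟨a, haA, ?_⟩)
    rw [abs_le] at *
    rcases mem_uIcc.1 ha with h | h <;> constructor <;> linarith [h.1, h.2]
  have hfin : P₁ (expansion ε (A ∪ D)ᶜ) + P₀ (expansion ε A) ≠ ∞ := by finiteness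
  refine (ENNReal.add_le_add_iff_left hfin).1 ?_
  calc P₁ (expansion ε (A ∪ D)ᶜ) + P₀ (expansion ε A) + P₁ (expansion ε D)
      = P₁ (expansion ε (A ∪ D)ᶜ) + P₁ (expansion ε D) + P₀ (expansion ε A) := by ring
    _ ≤ advRisk P₀ P₁ ε A := add_le_add h₁ le_rfl
    _ ≤ P₁ (expansion ε (A ∪ D)ᶜ) + P₀ (expansion ε (A ∪ D)) := h
    _ ≤ P₁ (expansion ε (A ∪ D)ᶜ) + (P₀ (expansion ε A) + P₀ (erosion ε D)) :=
        add_le_add le_rfl h₂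
    _ = _ := by ring

/-! ### Supports that miss the collars of an interval -/

/-- If an interval `I` is not charged near the right endpoint of `D`, it lies in a small
neighbourhood of that endpoint. -/
lemma subset_expansion_diff_erosion_of_lt {D I : Set ℝ} (hD : D.OrdConnected) (hI : I.OrdConnected)
    {ε₁ ε₂ : ℝ} (hε₁ : 0 ≤ ε₁) (hε : ε₁ < ε₂)
    (hlong : ∀ a b, D ⊆ Icc a b → 2 * ε₂ < b - a)
    (h₁ : ∀ U, IsOpen U → U ⊆ expansion ε₂ D \ expansion ε₁ D → Disjoint U I)
    (h₂ : ∀ U, IsOpen U → U ⊆ erosion ε₁ D \ erosion ε₂ D → Disjoint U I)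
    {x y : ℝ} (hx : x ∈ D) (hy : y ∉ D) (hxy : x < y)
    (hxI : ∃ i ∈ I, i < x + ε₂) (hyI : ∃ i ∈ I, y - ε₂ < i) :
    I ⊆ expansion ε₂ D \ erosion ε₂ D := by
  have hub : y ∈ upperBounds D := fun z hz ↦ by
    by_contra! hlt
    exact hy (hD.out hx hz ⟨hxy.le, hlt.le⟩)
  have hlub := isLUB_csSup ⟨x, hx⟩ ⟨y, hub⟩
  set d := sSup D
  have hxd : x ≤ d := hlub.1 hx
  have hdy : d ≤ y := hlub.2 hub
  have happ : ∀ t < d, ∃ w ∈ D, t < w := fun t ht ↦ (lt_isLUB_iff hlub).1 ht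
  obtain ⟨v, hv, hvd⟩ : ∃ v ∈ D, v < d - 2 * ε₂ := by
    by_contra! hcon
    have := hlong _ _ fun z hz ↦ ⟨hcon z hz, hlub.1 hz⟩
    linarith
  have hexp : Ioo (d - ε₂) (d + ε₂) ⊆ expansion ε₂ D := fun z hz ↦ by
    refine mem_expansion.2 ?_
    rcases le_total z d with hzd | hzd
    -- `z` may equal `d`, which need not belong to `D`; a step to the left stays in `D`, to the
    -- right of `v`.
    · refine ⟨z - ε₂ / 2, ?_, ?_⟩
      · obtain ⟨u, hu, hzu⟩ := happ (z - ε₂ / 2) (by linarith)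
        exact hD.out hv hu ⟨by linarith [hz.1], hzu.le⟩
      · rw [sub_sub_cancel, abs_of_nonneg (by linarith)]
        linarith
    · obtain ⟨w, hw, hzw⟩ := happ (z - ε₂) (by linarith [hz.2])
      have := hlub.1 hw
      exact ⟨w, hw, abs_le.2 ⟨by linarith, by linarith⟩⟩
  have hero : erosion ε₂ D ⊆ Iic (d - ε₂) := fun z hz ↦ by
    have := hlub.1 (mem_erosion.1 hz (z + ε₂) (by rw [sub_add_cancel_left, abs_neg,
      abs_of_nonneg (by linarith)]))
    rw [mem_Iic]
    linarith
  have hd₁ : Disjoint (Ioo (d + ε₁) (d + ε₂)) I := by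
    refine h₁ _ isOpen_Ioo fun z hz ↦ ⟨hexp ⟨by linarith [hz.1], hz.2⟩, fun hz' ↦ ?_⟩
    obtain ⟨w, hw, hzw⟩ := mem_expansion.1 hz'
    linarith [hlub.1 hw, hz.1, (abs_le.1 hzw).2]
  have hd₂ : Disjoint (Ioo (d - ε₂) (d - ε₁)) I := by
    refine h₂ _ isOpen_Ioo fun z hz ↦ ⟨mem_erosion.2 fun a ha ↦ ?_, fun hz' ↦ ?_⟩
    · rw [abs_le] at ha
      obtain ⟨u, hu, hau⟩ := happ a (by linarith [hz.2])
      exact hD.out hv hu ⟨by linarith [hz.1], hau.le⟩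
    · have := hero hz'
      rw [mem_Iic] at this
      linarith [hz.1]
  rw [disjoint_left] at hd₁ hd₂
  obtain ⟨i, hiI, hi⟩ := hxI
  obtain ⟨k, hkI, hk⟩ := hyI
  have hi' : i ≤ d + ε₁ := by
    by_contra! h
    exact hd₁ ⟨h, by linarith⟩ hiI
  have hk' : d - ε₁ ≤ k := by
    by_contra! h
    exact hd₂ ⟨by linarith, h⟩ hkI
  -- An interval meeting `I` on the near side of a collar cannot cross it.
  intro j hj
  have hj₁ : j ≤ d + ε₁ := by
    by_contra! h
    obtain ⟨m, hm, hm'⟩ := exists_between (lt_min h (add_lt_add_right hε d))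
    rw [lt_min_iff] at hm'
    exact hd₁ ⟨hm, hm'.2⟩ (hI.out hiI hj ⟨by linarith, hm'.1.le⟩)
  have hj₂ : d - ε₁ ≤ j := by
    by_contra! h
    obtain ⟨m, hm, hm'⟩ := exists_between (max_lt h (sub_lt_sub_left hε d))
    rw [max_lt_iff] at hm
    exact hd₂ ⟨hm.2, hm'⟩ (hI.out hj hkI ⟨hm.1.le, by linarith⟩)
  refine ⟨hexp ⟨by linarith, by linarith⟩, fun h ↦ ?_⟩
  have := hero h
  rw [mem_Iic] at this
  linarith

/-- If an interval `I` is not charged near the endpoints of `D`, and `D` cuts the expansion of `I`,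
then `I` lies in a small neighbourhood of an endpoint of `D`. -/
lemma subset_expansion_diff_erosion {D I : Set ℝ} (hD : D.OrdConnected) (hI : I.OrdConnected)
    {ε₁ ε₂ : ℝ} (hε₁ : 0 ≤ ε₁) (hε : ε₁ < ε₂)
    (hlong : ∀ a b, D ⊆ Icc a b → 2 * ε₂ < b - a)
    (h₁ : ∀ U, IsOpen U → U ⊆ expansion ε₂ D \ expansion ε₁ D → Disjoint U I)
    (h₂ : ∀ U, IsOpen U → U ⊆ erosion ε₁ D \ erosion ε₂ D → Disjoint U I)
    {x y : ℝ} (hx : x ∈ D) (hy : y ∉ D)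
    (hxJ : x ∈ interior (expansion ε₂ I)) (hyJ : y ∈ interior (expansion ε₂ I)) :
    I ⊆ expansion ε₂ D \ erosion ε₂ D := by
  have hlt : ∀ z ∈ interior (expansion ε₂ I), ∃ i ∈ I, i < z + ε₂ := fun z hz ↦ by
    obtain ⟨w, hw, hwz⟩ := (mem_nhdsLT_iff_exists_Ioo_subset.1
      (mem_nhdsWithin_of_mem_nhds (mem_interior_iff_mem_nhds.1 hz)))
    obtain ⟨m, hm⟩ := exists_between (mem_Iio.1 hw)
    obtain ⟨i, hi, him⟩ := mem_expansion.1 (hwz hm)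
    exact ⟨i, hi, by linarith [(abs_le.1 him).1, hm.2]⟩
  have hgt : ∀ z ∈ interior (expansion ε₂ I), ∃ i ∈ I, z - ε₂ < i := fun z hz ↦ by
    obtain ⟨w, hw, hwz⟩ := (mem_nhdsGT_iff_exists_Ioo_subset.1
      (mem_nhdsWithin_of_mem_nhds (mem_interior_iff_mem_nhds.1 hz)))
    obtain ⟨m, hm⟩ := exists_between (mem_Ioi.1 hw)
    obtain ⟨i, hi, him⟩ := mem_expansion.1 (hwz hm)
    exact ⟨i, hi, by linarith [(abs_le.1 him).2, hm.1]⟩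
  rcases lt_or_gt_of_ne (ne_of_mem_of_not_mem hx hy) with hxy | hxy
  · exact subset_expansion_diff_erosion_of_lt hD hI hε₁ hε hlong h₁ h₂ hx hy hxy (hlt x hxJ)
      (hgt y hyJ)
  · have hneg : ∀ {S : Set ℝ}, S.OrdConnected → (-S).OrdConnected :=
      fun hS ↦ hS.convex.neg.ordConnected
    have key := subset_expansion_diff_erosion_of_lt (D := -D) (I := -I) (x := -x) (y := -y)
      (hneg hD) (hneg hI) hε₁ hε
      (fun a b h ↦ by
        have := hlong (-b) (-a) fun z hz ↦ by
          have := h (Set.neg_mem_neg.2 hz)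
          exact ⟨by linarith [this.2], by linarith [this.1]⟩
        linarith)
      (fun U hU h ↦ by
        rw [expansion_neg, expansion_neg] at h
        have := h₁ (-U) hU.neg fun z hz ↦ by simpa using h hz
        rw [disjoint_left] at this ⊢
        exact fun z hz hz' ↦ this (Set.neg_mem_neg.2 hz) hz')
      (fun U hU h ↦ by
        rw [erosion_neg, erosion_neg] at h
        have := h₂ (-U) hU.neg fun z hz ↦ by simpa using h hz
        rw [disjoint_left] at this ⊢
        exact fun z hz hz' ↦ this (Set.neg_mem_neg.2 hz) hz')
      (by simpa using hx) (by simpa using hy) (by linarith)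
      (by
        obtain ⟨i, hi, h⟩ := hgt x hxJ
        exact ⟨-i, by simpa using hi, by linarith⟩)
      (by
        obtain ⟨i, hi, h⟩ := hlt y hyJ
        exact ⟨-i, by simpa using hi, by linarith⟩)
    rw [expansion_neg, erosion_neg] at key
    exact fun z hz ↦ by simpa using key (Set.neg_mem_neg.2 hz)

/-! ### Only the trace on the interior of the expanded support matters -/

/-- Translating a neighbourhood shows that every point within `ε` of an interior point of the
support is interior to the expansion. What remains is the complement of the support and its
frontier, null for an interval. -/
lemma measure_expansion_compl_interior {μ : Measure ℝ} (hμ : μ ≪ volume)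
    (hI : μ.support.OrdConnected) (ε : ℝ) :
    μ (expansion ε (interior (expansion ε μ.support))ᶜ) = 0 := by
  refine measure_mono_null (t := μ.supportᶜ ∪ frontier μ.support) (fun x hx ↦ ?_)
    (measure_union_null Measure.measure_compl_support
      (hμ (hI.convex.addHaar_frontier volume)))
  by_cases hxI : x ∈ μ.support
  · refine Or.inr ⟨subset_closure hxI, fun hxi ↦ ?_⟩
    obtain ⟨a, ha, hxa⟩ := mem_expansion.1 hx
    refine ha (mem_interior_iff_mem_nhds.2 ?_)
    have hc : Filter.Tendsto (fun b : ℝ ↦ b + (x - a)) (nhds a) (nhds x) := by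
      have := (continuous_add_const (x - a)).tendsto a
      rwa [add_sub_cancel] at this
    filter_upwards [hc (mem_interior_iff_mem_nhds.1 hxi)] with b hb
    exact mem_expansion.2 ⟨_, hb, by rwa [sub_add_cancel_left, abs_neg]⟩
  · exact Or.inl hxI

lemma measure_expansion_mono {μ ν : Measure ℝ} (hν : ν ≪ volume)
    (hI : ν.support.OrdConnected) (hμν : μ ≪ ν) {ε : ℝ} {A B : Set ℝ}
    (h : A ∩ interior (expansion ε ν.support) ⊆ B) :
    μ (expansion ε A) ≤ μ (expansion ε B) := by
  have hsub : A ⊆ B ∪ (interior (expansion ε ν.support))ᶜ := fun x hx ↦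
    (em (x ∈ interior (expansion ε ν.support))).imp (fun hxJ ↦ h ⟨hx, hxJ⟩) id
  calc μ (expansion ε A) ≤ μ (expansion ε (B ∪ (interior (expansion ε ν.support))ᶜ)) :=
        measure_mono (expansion_mono le_rfl hsub)
    _ ≤ μ (expansion ε B) + μ (expansion ε (interior (expansion ε ν.support))ᶜ) := by
        rw [expansion_union]; exact measure_union_le _ _
    _ = μ (expansion ε B) := by
        rw [hμν (measure_expansion_compl_interior hν hI ε), add_zero]

/-- Being a minimizer only depends on the trace on the interior of the expanded support. -/
lemma IsAdvBayes.congr {P₀ P₁ : Measure ℝ} (habs : P₀ + P₁ ≪ volume)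
    (hI : (P₀ + P₁).support.OrdConnected) {ε : ℝ} {A B : Set ℝ} (hA : IsAdvBayes P₀ P₁ ε A)
    (hB : MeasurableSet B)
    (h : ∀ x ∈ interior (expansion ε (P₀ + P₁).support), x ∈ A ↔ x ∈ B) :
    IsAdvBayes P₀ P₁ ε B := by
  refine ⟨hB, fun C hC ↦ le_trans (add_le_add ?_ ?_) (hA.2 C hC)⟩
  · exact measure_expansion_mono habs hI (Measure.le_add_left le_rfl).absolutelyContinuous
      fun x hx hxA ↦ hx.1 ((h x hx.2).1 hxA)
  · exact measure_expansion_mono habs hI (Measure.le_add_right le_rfl).absolutelyContinuous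
      fun x hx ↦ (h x hx.2).2 hx.1

lemma measure_diff_eq_zero_of_le {μ : Measure ℝ} [IsFiniteMeasure μ] {S T : Set ℝ}
    (hS : MeasurableSet S) (hST : S ⊆ T) (h : μ T ≤ μ S) : μ (T \ S) = 0 := by
  rw [measure_sdiff hST hS.nullMeasurableSet (measure_ne_top _ _), tsub_eq_zero_of_le h]

/-! ### Comparing the two radii -/

/-- A component of the complement of the classifier for the larger radius can only be contained in
the classifier for the smaller radius if it covers everything relevant. -/
lemma interior_expansion_subset_component {P₀ P₁ : Measure ℝ} [IsFiniteMeasure P₀]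
    [IsFiniteMeasure P₁] (habs : P₀ + P₁ ≪ volume) (hI : (P₀ + P₁).support.OrdConnected)
    (hP₀ : P₀ + P₁ ≪ P₀) (hP₁ : P₀ + P₁ ≪ P₁) {ε₁ ε₂ : ℝ} (hε₁ : 0 ≤ ε₁) (hε : ε₁ < ε₂)
    {A₁ A₂ : Set ℝ} (hA₁ : IsAdvBayes P₀ P₁ ε₁ A₁) (hA₂ : IsAdvBayes P₀ P₁ ε₂ A₂)
    (hreg : IsRegularSet ε₂ A₂) {x : ℝ} (hx : x ∉ A₂)
    (hxJ : x ∈ interior (expansion ε₂ (P₀ + P₁).support))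
    (hsub : A₂ᶜ.ordConnectedComponent x ∩ interior (expansion ε₁ (P₀ + P₁).support) ⊆ A₁) :
    interior (expansion ε₂ (P₀ + P₁).support) ⊆ A₂ᶜ.ordConnectedComponent x := by
  intro y hyJ
  by_contra hy
  have h₂ := hA₂.measure_expansion_le hreg x
  have hlong : ∀ a b, A₂ᶜ.ordConnectedComponent x ⊆ Icc a b → 2 * ε₂ < b - a :=
    fun a b h ↦ hreg.2.lt_of_subset_Icc hx h
  have hxD : x ∈ A₂ᶜ.ordConnectedComponent x := self_mem_ordConnectedComponent.2 hx
  have hD : (A₂ᶜ.ordConnectedComponent x).OrdConnected := inferInstance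
  generalize A₂ᶜ.ordConnectedComponent x = D at *
  have h₁ : P₀ (erosion ε₁ D) ≤ P₁ (expansion ε₁ D) := by
    -- Outside `J₁` membership is free, so `A₁` may be enlarged to contain all of `D`.
    refine (hA₁.congr habs hI (B := A₁ ∪ D \ interior (expansion ε₁ (P₀ + P₁).support))
      (hA₁.1.union (hD.measurableSet.diff isOpen_interior.measurableSet)) fun z hz ↦
        ?_).measure_erosion_le hε₁ hD fun z hz ↦ ?_
    · simp [hz]
    · by_cases hzJ : z ∈ interior (expansion ε₁ (P₀ + P₁).support)
      · exact Or.inl (hsub ⟨hz, hzJ⟩)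
      · exact Or.inr ⟨hz, hzJ⟩
  have hero : P₀ (erosion ε₂ D) ≤ P₀ (erosion ε₁ D) := measure_mono (erosion_anti hε.le D)
  have hexp : P₁ (expansion ε₁ D) ≤ P₁ (expansion ε₂ D) :=
    measure_mono (expansion_mono hε.le Subset.rfl)
  -- The four inequalities close into a cycle, so each is an equality.
  have n₁ : (P₀ + P₁) (expansion ε₂ D \ expansion ε₁ D) = 0 :=
    hP₁ (measure_diff_eq_zero_of_le (ordConnected_expansion ε₁ hD).measurableSet
      (expansion_mono hε.le Subset.rfl) (h₂.trans (hero.trans h₁)))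
  have n₂ : (P₀ + P₁) (erosion ε₁ D \ erosion ε₂ D) = 0 :=
    hP₀ (measure_diff_eq_zero_of_le (ordConnected_erosion ε₂ hD).measurableSet
      (erosion_anti hε.le D) (h₁.trans (hexp.trans h₂)))
  have hnull : ∀ U, IsOpen U → (P₀ + P₁) U = 0 → Disjoint U (P₀ + P₁).support :=
    fun U hU h ↦ disjoint_left.2 fun z hz ↦ Measure.subset_compl_support_of_isOpen hU h hz
  have hsupp := subset_expansion_diff_erosion hD hI hε₁ hε hlong
    (fun U hU h ↦ hnull U hU (measure_mono_null h n₁))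
    (fun U hU h ↦ hnull U hU (measure_mono_null h n₂)) hxD hy hxJ hyJ
  have hze : P₀ (erosion ε₂ D) = 0 :=
    (Measure.le_add_right le_rfl).absolutelyContinuous
      (measure_mono_null (fun z hz hzI ↦ (hsupp hzI).2 hz)
        (Measure.measure_compl_support (μ := P₀ + P₁)))
  have hzP : (P₀ + P₁) (expansion ε₂ D) = 0 := hP₁ (le_antisymm (h₂.trans hze.le) zero_le)
  have hzero : P₀ + P₁ = 0 := by
    rw [← Measure.measure_univ_eq_zero, ← union_compl_self (P₀ + P₁).support]
    exact measure_union_null (measure_mono_null (fun z hz ↦ (hsupp hz).1) hzP)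
      Measure.measure_compl_support
  rw [hzero, Measure.support_zero, expansion_empty, interior_empty] at hxJ
  exact hxJ

/-- Monotonicity of the number of components, on the interior of the expanded support. -/
lemma comp_inter_interior_le {P₀ P₁ : Measure ℝ} [IsFiniteMeasure P₀]
    [IsFiniteMeasure P₁] (habs : P₀ + P₁ ≪ volume) (hI : (P₀ + P₁).support.OrdConnected)
    (hP₀ : P₀ + P₁ ≪ P₀) (hP₁ : P₀ + P₁ ≪ P₁) {ε₁ ε₂ : ℝ} (hε₁ : 0 ≤ ε₁) (hε : ε₁ < ε₂)
    {A₁ A₂ : Set ℝ} (hA₁ : IsAdvBayes P₀ P₁ ε₁ A₁) (hA₂ : IsAdvBayes P₀ P₁ ε₂ A₂)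
    (hreg : IsRegularSet ε₂ A₂)
    (hopp : ¬ AreOppositeConstant (interior (expansion ε₁ (P₀ + P₁).support))
      (interior (expansion ε₂ (P₀ + P₁).support)) A₁ A₂) :
    comp (A₂ ∩ interior (expansion ε₂ (P₀ + P₁).support)) ≤
      comp (A₁ ∩ interior (expansion ε₁ (P₀ + P₁).support)) := by
  have hc : P₁ + P₀ = P₀ + P₁ := add_comm _ _
  have key₀ := @interior_expansion_subset_component P₀ P₁ _ _ habs hI hP₀ hP₁ ε₁ ε₂ hε₁ hε
    A₁ A₂ hA₁ hA₂ hreg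
  -- Exchanging the labels turns components of `A₂ᶜ` into components of `A₂`.
  have key₁ := @interior_expansion_subset_component P₁ P₀ _ _ (hc ▸ habs) (hc ▸ hI) (hc ▸ hP₁)
    (hc ▸ hP₀) ε₁ ε₂ hε₁ hε A₁ᶜ A₂ᶜ hA₁.compl hA₂.compl hreg.compl
  rw [hc] at key₁
  have hJJ : interior (expansion ε₁ (P₀ + P₁).support) ⊆
      interior (expansion ε₂ (P₀ + P₁).support) :=
    interior_mono (expansion_mono hε.le Subset.rfl)
  have hJ₂ : (interior (expansion ε₂ (P₀ + P₁).support)).OrdConnected :=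
    (ordConnected_expansion ε₂ hI).convex.interior.ordConnected
  generalize interior (expansion ε₁ (P₀ + P₁).support) = J₁ at *
  generalize interior (expansion ε₂ (P₀ + P₁).support) = J₂ at *
  apply comp_le_comp
  · rintro x ⟨hxA, hxJ⟩
    by_contra! hcon
    have hsub : A₂.ordConnectedComponent x ∩ J₁ ⊆ A₁ᶜ := fun y hy hyA ↦
      hcon y ⟨hyA, hy.2⟩ (subset_inter hy.1 (hJ₂.uIcc_subset hxJ (hJJ hy.2)))
    have hJ : J₂ ⊆ A₂.ordConnectedComponent x := by
      have := key₁ (x := x) (by simpa using hxA) hxJ (by simpa using hsub)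
      simpa using this
    exact hopp (Or.inr ⟨disjoint_left.2 fun y hy ↦ hsub ⟨hJ (hJJ hy), hy⟩,
      hJ.trans ordConnectedComponent_subset⟩)
  · rintro x ⟨-, hxA, hxJ⟩ y ⟨-, hyA, hyJ⟩ hxy z hz
    refine ⟨by_contra fun hzA ↦ ?_, hJ₂.uIcc_subset hxJ hyJ hz⟩
    have hnot : ∀ w ∈ A₂, w ∉ A₂ᶜ.ordConnectedComponent z :=
      fun w hw h ↦ ordConnectedComponent_subset h hw
    -- The gap through `z` cannot pass `x` or `y`, so it lies in `A₁` and would have to cover `J₂`,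
    -- including `x`.
    have hsub : A₂ᶜ.ordConnectedComponent z ⊆ uIcc x y := fun w hw ↦ by
      by_contra hcon
      have hx : x ∉ uIcc z w := fun h ↦ hw h hxA
      have hy : y ∉ uIcc z w := fun h ↦ hw h hyA
      simp only [mem_uIcc] at hz hcon hx hy
      grind
    exact hnot x hxA (key₀ hzA (hJJ (hxy hz).2) (fun w hw ↦ (hxy (hsub hw.1)).1) hxJ)

lemma comp_inter_mono {A J J' : Set ℝ} (hJ : J.OrdConnected) (h : J ⊆ J') :
    comp (A ∩ J) ≤ comp (A ∩ J') :=
  comp_le_comp (fun x hx ↦ ⟨x, ⟨hx.1, h hx.2⟩, by simpa using hx⟩)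
    fun _ hx _ hy hxy ↦ subset_inter (hxy.trans inter_subset_left)
      (hJ.uIcc_subset hx.2.2 hy.2.2)

/-- A point of `A` on the frontier of `J` is interior to `A` by `hd`, so a short segment in `A`
joins it to `interior J`. -/
lemma comp_inter_le_comp_inter_interior {A J : Set ℝ} (hJ : J.OrdConnected)
    (hne : (interior J).Nonempty) (hd : Disjoint (frontier A) (frontier J)) :
    comp (A ∩ J) ≤ comp (A ∩ interior J) := by
  refine comp_le_comp (fun x hx ↦ ?_) fun _ _ _ _ h ↦
    h.trans (inter_subset_inter_right _ interior_subset)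
  by_cases hxi : x ∈ interior J
  · exact ⟨x, ⟨hx.1, hxi⟩, by simpa using hx⟩
  have hxA : x ∈ interior A := by
    by_contra h
    exact disjoint_left.1 hd ⟨subset_closure hx.1, h⟩ ⟨subset_closure hx.2, hxi⟩
  obtain ⟨δ, hδ, hball⟩ := Metric.mem_nhds_iff.1 (mem_interior_iff_mem_nhds.1 hxA)
  have hxc : x ∈ closure (interior J) := by
    rw [hJ.convex.closure_interior_eq_closure_of_nonempty_interior (𝕜 := ℝ) hne]
    exact subset_closure hx.2
  obtain ⟨y, hy, hxy⟩ := Metric.mem_closure_iff.1 hxc δ hδ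
  have hyb : y ∈ Metric.ball x δ := by rwa [Metric.mem_ball, dist_comm]
  exact ⟨y, ⟨hball hyb, hy⟩, subset_inter
    (((convex_ball x δ).ordConnected.uIcc_subset (Metric.mem_ball_self hδ) hyb).trans hball)
    (hJ.uIcc_subset hx.2 (interior_subset hy))⟩

lemma comp_inter_expansion_le {I A₁ A₂ : Set ℝ} (hI : I.OrdConnected) (hne : I.Nonempty)
    {ε₁ ε₂ : ℝ} (hε₂ : 0 < ε₂)
    (h : comp (A₂ ∩ interior (expansion ε₂ I)) ≤ comp (A₁ ∩ interior (expansion ε₁ I)))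
    (hd : Disjoint (frontier A₂) (frontier (expansion ε₂ I))) :
    comp (A₂ ∩ expansion ε₂ I) ≤ comp (A₁ ∩ expansion ε₁ I) := by
  obtain ⟨i, hi⟩ := hne
  have hball : Metric.ball i ε₂ ⊆ expansion ε₂ I := fun z hz ↦
    mem_expansion.2 ⟨i, hi, (Metric.mem_ball.1 hz).le⟩
  exact (comp_inter_le_comp_inter_interior (ordConnected_expansion ε₂ hI)
    ⟨i, interior_maximal hball Metric.isOpen_ball (Metric.mem_ball_self hε₂)⟩ hd).trans
    (h.trans (comp_inter_mono (ordConnected_expansion ε₁ hI).convex.interior.ordConnected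
      interior_subset))

/-- Opposite constant minimizers force both constant classifiers to be optimal. -/
lemma isAdvBayes_const_of_opposite {P₀ P₁ : Measure ℝ} {ε ε' : ℝ} (hε : 0 ≤ ε) (hε' : 0 ≤ ε')
    (h : IsAdvBayes P₀ P₁ ε univ) (h' : IsAdvBayes P₀ P₁ ε' ∅) :
    IsAdvBayes P₀ P₁ ε ∅ ∧ IsAdvBayes P₀ P₁ ε' univ := by
  have hr : ∀ δ : ℝ, 0 ≤ δ → advRisk P₀ P₁ δ univ = P₀ univ ∧ advRisk P₀ P₁ δ ∅ = P₁ univ :=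
    fun δ hδ ↦ by simp [advRisk, expansion_univ hδ]
  obtain ⟨hu, he⟩ := hr ε hε
  obtain ⟨hu', he'⟩ := hr ε' hε'
  have h₁ : P₀ univ ≤ P₁ univ := by rw [← hu, ← he]; exact h.2 _ .empty
  have h₂ : P₁ univ ≤ P₀ univ := by rw [← hu', ← he']; exact h'.2 _ .univ
  refine ⟨⟨.empty, fun B hB ↦ le_trans ?_ (h.2 B hB)⟩,
    ⟨.univ, fun B hB ↦ le_trans ?_ (h'.2 B hB)⟩⟩
  · rwa [hu, he]
  · rwa [hu', he']

end AdvBayes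

theorem mainTheorem6 (P₀ P₁ : Measure ℝ) [IsFiniteMeasure P₀] [IsFiniteMeasure P₁]
    (habs : P₀ + P₁ ≪ volume)
    (I : Set ℝ) (hI : I = (P₀ + P₁).support) (hIint : I.OrdConnected)
    (hη : (P₀ + P₁) {x | P₁.rnDeriv (P₀ + P₁) x = 0 ∨ P₁.rnDeriv (P₀ + P₁) x = 1} = 0)
    (ε₁ ε₂ : ℝ) (hε₁ : 0 ≤ ε₁) (hε : ε₁ < ε₂)
    (A₁ A₂ : Set ℝ)
    (hA₁ : AdvBayes.IsAdvBayes P₀ P₁ ε₁ A₁) (hreg₁ : AdvBayes.IsRegularSet ε₁ A₁)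
    (hA₂ : AdvBayes.IsAdvBayes P₀ P₁ ε₂ A₂) (hreg₂ : AdvBayes.IsRegularSet ε₂ A₂) :
    (¬ AdvBayes.AreOppositeConstant (interior (AdvBayes.expansion ε₁ I))
          (interior (AdvBayes.expansion ε₂ I)) A₁ A₂ →
      (AdvBayes.comp (A₂ ∩ interior (AdvBayes.expansion ε₂ I)) ≤
          AdvBayes.comp (A₁ ∩ interior (AdvBayes.expansion ε₁ I)) ∧
        AdvBayes.comp (A₂ᶜ ∩ interior (AdvBayes.expansion ε₂ I)) ≤
          AdvBayes.comp (A₁ᶜ ∩ interior (AdvBayes.expansion ε₁ I))) ∧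
      (Disjoint (frontier A₂) (frontier (AdvBayes.expansion ε₂ I)) →
        AdvBayes.comp (A₂ ∩ AdvBayes.expansion ε₂ I) ≤
            AdvBayes.comp (A₁ ∩ AdvBayes.expansion ε₁ I) ∧
          AdvBayes.comp (A₂ᶜ ∩ AdvBayes.expansion ε₂ I) ≤
            AdvBayes.comp (A₁ᶜ ∩ AdvBayes.expansion ε₁ I))) ∧
    (AdvBayes.AreOppositeConstant (interior (AdvBayes.expansion ε₁ I))
          (interior (AdvBayes.expansion ε₂ I)) A₁ A₂ →
      AdvBayes.IsAdvBayes P₀ P₁ ε₁ ∅ ∧ AdvBayes.IsAdvBayes P₀ P₁ ε₁ univ ∧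
        AdvBayes.IsAdvBayes P₀ P₁ ε₂ ∅ ∧ AdvBayes.IsAdvBayes P₀ P₁ ε₂ univ) := by
  subst hI
  have hc : P₁ + P₀ = P₀ + P₁ := add_comm _ _
  obtain ⟨hP₀, hP₁⟩ := AdvBayes.absolutelyContinuous_of_rnDeriv hη
  have hε₂ : 0 < ε₂ := hε₁.trans_lt hε
  refine ⟨fun hopp ↦ ?_, ?_⟩
  · have hA := AdvBayes.comp_inter_interior_le habs hIint hP₀ hP₁ hε₁ hε hA₁ hA₂ hreg₂ hopp
    have hAc := AdvBayes.comp_inter_interior_le (hc ▸ habs) (hc ▸ hIint) (hc ▸ hP₁) (hc ▸ hP₀)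
      hε₁ hε hA₁.compl hA₂.compl hreg₂.compl (fun h ↦ hopp (by
        rw [hc] at h
        rcases h with ⟨h, h'⟩ | ⟨h, h'⟩
        · exact Or.inr ⟨subset_compl_iff_disjoint_right.1 h, disjoint_compl_right_iff_subset.1 h'⟩
        · exact Or.inl ⟨disjoint_compl_right_iff_subset.1 h, subset_compl_iff_disjoint_right.1 h'⟩))
    rw [hc] at hAc
    -- An empty support makes `J₁` and `J₂` empty, and the pair is vacuously opposite constant.
    have hne : (P₀ + P₁).support.Nonempty := by
      by_contra h
      rw [not_nonempty_iff_eq_empty] at h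
      exact hopp (Or.inl (by simp [h]))
    refine ⟨⟨hA, hAc⟩, fun hd ↦ ⟨AdvBayes.comp_inter_expansion_le hIint hne hε₂ hA hd,
      AdvBayes.comp_inter_expansion_le hIint hne hε₂ hAc (by rwa [frontier_compl])⟩⟩
  · rintro (⟨h₁, h₂⟩ | ⟨h₁, h₂⟩)
    · have k₁ := hA₁.congr habs hIint .univ fun x hx ↦ by simp [h₁ hx]
      have k₂ := hA₂.congr habs hIint .empty fun x hx ↦ by simp [disjoint_left.1 h₂ hx]
      obtain ⟨k₃, k₄⟩ := AdvBayes.isAdvBayes_const_of_opposite hε₁ hε₂.le k₁ k₂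
      exact ⟨k₃, k₁, k₂, k₄⟩
    · have k₁ := hA₁.congr habs hIint .empty fun x hx ↦ by simp [disjoint_left.1 h₁ hx]
      have k₂ := hA₂.congr habs hIint .univ fun x hx ↦ by simp [h₂ hx]
      obtain ⟨k₃, k₄⟩ := AdvBayes.isAdvBayes_const_of_opposite hε₂.le hε₁ k₂ k₁
      exact ⟨k₁, k₄, k₃, k₂⟩
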